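/- For a polytope $P$ let $f_P(t)=\sum_{i=0}^{\dim P} f_i\,t^i$ be its $f$-polynomial, where $f_i$ is the number of $i$-dimensional nonempty faces of $P$ ($P$ itself included). Let $\Delta_{k,n}\subseteq\mathbb{R}^n$ be the hypersimplex, i.e. the convex hull of the indicator vectors of the $k$-element subsets of $[n]$. For $F\subseteq[n]$ and $r\ge 0$ let $P(\Lambda_{k,F,r})=\{x\in\Delta_{k,n} : \sum_{i\in F}x_i\le r\}$ (the base polytope of the Schubert elementary split matroid of rank $k$ on $[n]$ with proper cyclic flat $F$ of rank $r$). Put $$u_{r,k,h,n}(t)=f_{\Delta_{k,n}}(t)-f_{P(\Lambda_{k,\{1,\dots,h\},r})}(t),$$ $$w_{\alpha,\beta,a,b}(t)=f_{\Delta_{\alpha+\beta,a+b}}(t)-f_{\Delta_{\alpha,a}}(t)\,f_{\Delta_{\beta,b}}(t)-u_{\alpha,\alpha+\beta,a,a+b}(t)-u_{\beta,\alpha+\beta,b,a+b}(t).$$ Let $N$ be a matroid of rank $k$ on $[n]$ with exactly four cyclic flats (flats that are unions of circuits), namely $\varnothing$, $F$, $G$ and $F\cup G=[n]$, of rank $0$,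 $r_F$, $r_G$ and $k$ respectively. (Such a matroid is automatically a split matroid.) Let $P(N)$ be its base polytope, the convex hull of the indicator vectors of its bases, and let $c=|F\cap G|$. Then $c+k\le r_F+r_G$, and: * if $c+k<r_F+r_G$, then $$f_{P(N)}(t)=f_{P(\Lambda_{k,F,r_F})}(t)+f_{P(\Lambda_{k,G,r_G})}(t)-f_{\Delta_{k,n}}(t);$$ * if $c+k=r_F+r_G$, then $$f_{P(N)}(t)=f_{P(\Lambda_{k,F,r_F})}(t)+f_{P(\Lambda_{k,G,r_G})}(t)-f_{\Delta_{k,n}}(t)-w_{r_F-c,\;r_G-c,\;|F|-c,\;|G|-c}(t).$$ -/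

import Mathlib

open Polynomial

/-- A *cyclic flat* of a matroid is a flat that is a union of circuits. -/
def Matroid.IsCyclicFlat {α : Type*} (M : Matroid α) (Z : Set α) : Prop :=
  M.IsFlat Z ∧ ∀ e ∈ Z, ∃ C, M.IsCircuit C ∧ e ∈ C ∧ C ⊆ Z

namespace SplitMatroidFaces

/-- The base polytope of a matroid on `[n]`: the convex hull in `ℝⁿ` of the indicator vectors of
its bases. -/
def basePolytope {n : ℕ} (M : Matroid (Fin n)) : Set (Fin n → ℝ) :=
  convexHull ℝ ((fun B : Set (Fin n) ↦ B.indicator 1) '' {B | M.IsBase B})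

/-- The hypersimplex `Δ_{k,n}`: the convex hull of the indicator vectors of all `k`-element subsets
of `[n]`, i.e. of the bases of the uniform matroid of rank `k` on `n` elements. -/
def hypersimplex (k n : ℕ) : Set (Fin n → ℝ) :=
  convexHull ℝ ((fun B : Finset (Fin n) ↦ (B : Set (Fin n)).indicator 1) '' {B | B.card = k})

/-- The base polytope of the Schubert elementary split matroid of rank `k` on `[n]` whose proper
cyclic flat is `F`, of rank `r`: the part of the hypersimplex `Δ_{k,n}` in the half-space
`∑_{i ∈ F} x_i ≤ r`. -/
def schubertPolytope {n : ℕ} (k : ℕ) (F : Finset (Fin n)) (r : ℕ) : Set (Fin n → ℝ) :=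
  {x ∈ hypersimplex k n | ∑ i ∈ F, x i ≤ r}

/-- The number of `i`-dimensional (nonempty) faces of a polytope `P`, where `P` is a face of itself.
The faces of a polytope are its exposed faces, i.e. the sets of maximizers of linear functionals. -/
noncomputable def faceCount {n : ℕ} (P : Set (Fin n → ℝ)) (i : ℕ) : ℕ :=
  {Q : Set (Fin n → ℝ) | Q.Nonempty ∧ IsExposed ℝ P Q ∧
    Module.finrank ℝ (vectorSpan ℝ Q) = i}.ncard

/-- The `f`-polynomial `f_P(t) = ∑_{i=0}^{dim P} f_i t^i` of a polytope `P`. -/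
noncomputable def fPoly {n : ℕ} (P : Set (Fin n → ℝ)) : ℤ[X] :=
  ∑ i ∈ Finset.range (Module.finrank ℝ (vectorSpan ℝ P) + 1), C (faceCount P i : ℤ) * X ^ i

/-- `u_{r,k,h,n}(t) = f_{Δ_{k,n}}(t) - f_{P(Λ_{k-r,k,n-h,n})}(t)`, where `Λ_{k-r,k,n-h,n}` is the
Schubert elementary split matroid of rank `k` on `[n]` with the first `h` elements as proper cyclic
flat, of rank `r`. -/
noncomputable def uPoly (r k h n : ℕ) : ℤ[X] :=
  fPoly (hypersimplex k n) -
    fPoly (schubertPolytope k (Finset.univ.filter fun i : Fin n ↦ (i : ℕ) < h) r)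

/-- The polynomial `w_{α,β,a,b}(t)`. -/
noncomputable def wPoly (α β a b : ℕ) : ℤ[X] :=
  fPoly (hypersimplex (α + β) (a + b)) - fPoly (hypersimplex α a) * fPoly (hypersimplex β b) -
    uPoly α (α + β) a (a + b) - uPoly β (α + β) b (a + b)

end SplitMatroidFaces

open SplitMatroidFaces

/-! Faces of a polyhedron given by finitely many inequalities correspond to the sets `T` of
inequalities that are exactly the tight ones at some point, and the dimension of the face is that of
the common kernel of the functionals in `T` (`facePoly_polyhedron`). So the `f`-polynomial is a sum
over `T`, whose exponents do not involve the bounds.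

A circuit spans a cyclic flat, so the bases of `N` are the `k`-sets that meet `F` and `G` in at most
`rF` and `rG` elements. Since `F ∪ G` is everything, the hypersimplex cut by both half-spaces is
integral and equals the base polytope (`basePolytope_eq_slice`). The Schubert polytopes and the
hypersimplex are the same slice with one or both bounds replaced by `k + 1`, which is never
attained. All four `f`-polynomials are thus sums over the same sets `T`.

Termwise, inclusion-exclusion holds unless a relatively open face of the hypersimplex has a point in
both closed regions cut off (`realized_cut_add`). At such a point the coordinates in `F ∩ G` sum to
at least `rF + rG - k`, but they sum to at most `c`. If `c + k < rF + rG` this is impossible. If `c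
+ k = rF + rG` they are all `1`, so inclusion-exclusion can fail only for `T` containing the
inequalities `x i ≤ 1` with `i ∈ F ∩ G`. The terms for these `T` enumerate the faces of the four
polytopes after deleting the coordinates in `F ∩ G`: two Schubert polytopes, a hypersimplex and a
product of two hypersimplices. Their combination is `w` (`wPoly_eq_sum`). -/

namespace SplitMatroidFaces

/-! ### Faces of polyhedra and sets of tight inequalities -/

section Polyhedra

variable {V : Type*} [NormedAddCommGroup V] [NormedSpace ℝ V]

/-- The number of `i`-dimensional nonempty exposed faces of a subset of a normed space. -/
noncomputable def exposedCount (P : Set V) (i : ℕ) : ℕ :=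
  {Q : Set V | Q.Nonempty ∧ IsExposed ℝ P Q ∧ Module.finrank ℝ (vectorSpan ℝ Q) = i}.ncard

/-- The `f`-polynomial of a subset of a normed space. -/
noncomputable def facePoly (P : Set V) : ℤ[X] :=
  ∑ i ∈ Finset.range (Module.finrank ℝ (vectorSpan ℝ P) + 1), C (exposedCount P i : ℤ) * X ^ i

theorem fPoly_eq_facePoly {n : ℕ} (P : Set (Fin n → ℝ)) : fPoly P = facePoly P := rfl

variable {J : Type*} (ℓ : J → V →ₗ[ℝ] ℝ) (c : J → ℝ)

/-- The solution set of the linear inequalities `ℓ j x ≤ c j`. -/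
def polyhedron : Set V := {x | ∀ j, ℓ j x ≤ c j}

open Classical in
/-- The indices of the inequalities which hold with equality at `x`. -/
noncomputable def tight [Fintype J] (x : V) : Finset J := {j | ℓ j x = c j}

/-- The common kernel of the functionals indexed by `T`. -/
def commonKer (T : Finset J) : Submodule ℝ V where
  carrier := {v | ∀ j ∈ T, ℓ j v = 0}
  add_mem' hx hy j hj := by simp [hx j hj, hy j hj]
  zero_mem' j _ := by simp
  smul_mem' a x hx j hj := by simp [hx j hj]

/-- `T` is the set of tight inequalities at some point of the polyhedron. -/
def Realized [Fintype J] (T : Finset J) : Prop := ∃ x ∈ polyhedron ℓ c, tight ℓ c x = T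

variable {ℓ c}

theorem mem_commonKer {T : Finset J} {v : V} : v ∈ commonKer ℓ T ↔ ∀ j ∈ T, ℓ j v = 0 := Iff.rfl

theorem mem_polyhedron {x : V} : x ∈ polyhedron ℓ c ↔ ∀ j, ℓ j x ≤ c j := Iff.rfl

theorem convex_polyhedron : Convex ℝ (polyhedron ℓ c) := by
  intro x hx y hy a b ha hb hab j
  have h1 := mul_le_mul_of_nonneg_left (hx j) ha
  have h2 := mul_le_mul_of_nonneg_left (hy j) hb
  have h3 : c j = a * c j + b * c j := by rw [← add_mul, hab, one_mul]
  simp only [map_add, map_smul, smul_eq_mul]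
  linarith

variable [Fintype J]

theorem mem_tight {x : V} {j : J} : j ∈ tight ℓ c x ↔ ℓ j x = c j := by simp [tight]

theorem tight_midpoint {x y : V} (hx : x ∈ polyhedron ℓ c) (hy : y ∈ polyhedron ℓ c) {a b : ℝ}
    (ha : 0 < a) (hb : 0 < b) (hab : a + b = 1) {j : J} :
    j ∈ tight ℓ c (a • x + b • y) ↔ j ∈ tight ℓ c x ∧ j ∈ tight ℓ c y := by
  have hxj := hx j
  have hyj := hy j
  have h3 : c j = a * c j + b * c j := by rw [← add_mul, hab, one_mul]
  simp only [mem_tight, map_add, map_smul, smul_eq_mul]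
  constructor
  · intro h
    constructor
    · by_contra hne
      have := mul_lt_mul_of_pos_left (lt_of_le_of_ne hxj hne) ha
      have := mul_le_mul_of_nonneg_left hyj hb.le
      linarith
    · by_contra hne
      have := mul_lt_mul_of_pos_left (lt_of_le_of_ne hyj hne) hb
      have := mul_le_mul_of_nonneg_left hxj ha.le
      linarith
  · rintro ⟨h1, h2⟩
    rw [h1, h2, ← h3]

-- Inequalities that are slack at `x` stay slack for small steps, so only the tight ones restrict
-- the direction.
open Filter Topology in
theorem eventually_add_smul_mem {x v : V} (hx : x ∈ polyhedron ℓ c)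
    (hv : ∀ j ∈ tight ℓ c x, ℓ j v ≤ 0) :
    ∀ᶠ t : ℝ in 𝓝[>] 0, x + t • v ∈ polyhedron ℓ c := by
  have : ∀ j, ∀ᶠ t : ℝ in 𝓝[>] 0, ℓ j (x + t • v) ≤ c j := by
    intro j
    by_cases hj : j ∈ tight ℓ c x
    · filter_upwards [self_mem_nhdsWithin] with t ht
      have h1 := mem_tight.1 hj
      have h2 := mul_nonpos_of_nonneg_of_nonpos (le_of_lt (Set.mem_Ioi.1 ht)) (hv j hj)
      simp only [map_add, map_smul, smul_eq_mul]
      linarith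
    · have hlt : ℓ j x < c j := lt_of_le_of_ne (hx j) fun h ↦ hj (mem_tight.2 h)
      have hc : Tendsto (fun t : ℝ ↦ ℓ j x + t * ℓ j v) (𝓝 0) (𝓝 (ℓ j x + 0 * ℓ j v)) :=
        (by fun_prop : Continuous fun t : ℝ ↦ ℓ j x + t * ℓ j v).tendsto 0
      rw [zero_mul, add_zero] at hc
      filter_upwards [nhdsWithin_le_nhds (hc.eventually_lt_const hlt)] with t ht
      simp only [map_add, map_smul, smul_eq_mul]
      exact ht.le
  exact (eventually_all.2 this)

theorem exists_add_smul_mem {x v : V} (hx : x ∈ polyhedron ℓ c)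
    (hv : ∀ j ∈ tight ℓ c x, ℓ j v ≤ 0) : ∃ t : ℝ, 0 < t ∧ x + t • v ∈ polyhedron ℓ c := by
  obtain ⟨t, h1, h2⟩ :=
    ((eventually_add_smul_mem hx hv).and self_mem_nhdsWithin).exists
  exact ⟨t, h2, h1⟩

/-- The face of the polyhedron where the inequalities in `T` are tight. -/
def tightFace (ℓ : J → V →ₗ[ℝ] ℝ) (c : J → ℝ) (T : Finset J) : Set V :=
  {y ∈ polyhedron ℓ c | T ⊆ tight ℓ c y}

theorem Realized.nonempty_tightFace {T : Finset J} (hT : Realized ℓ c T) :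
    (tightFace ℓ c T).Nonempty := by
  obtain ⟨x, hx, rfl⟩ := hT
  exact ⟨x, hx, subset_rfl⟩

theorem tightFace_injOn : Set.InjOn (tightFace ℓ c) {T | Realized ℓ c T} := by
  rintro _ ⟨x, hx, rfl⟩ _ ⟨y, hy, rfl⟩ h
  have h1 : x ∈ tightFace ℓ c (tight ℓ c y) := h ▸ ⟨hx, subset_rfl⟩
  have h2 : y ∈ tightFace ℓ c (tight ℓ c x) := h.symm ▸ ⟨hy, subset_rfl⟩
  exact h2.2.antisymm h1.2

/-- A point whose tight set is exactly `T` is a relative interior point: it can be moved a little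
along any vector of the common kernel. -/
theorem vectorSpan_tightFace {T : Finset J} (hT : Realized ℓ c T) :
    vectorSpan ℝ (tightFace ℓ c T) = commonKer ℓ T := by
  apply le_antisymm
  · rw [vectorSpan_def, Submodule.span_le]
    rintro _ ⟨y, hy, z, hz, rfl⟩ j hj
    have h1 := mem_tight.1 (hy.2 hj)
    have h2 := mem_tight.1 (hz.2 hj)
    simp [h1, h2]
  · obtain ⟨x, hx, rfl⟩ := hT
    intro v hv
    obtain ⟨t, ht, hm⟩ := exists_add_smul_mem hx (v := v) (fun j hj ↦ (hv j hj).le)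
    have hf : x + t • v ∈ tightFace ℓ c (tight ℓ c x) := by
      refine ⟨hm, fun j hj ↦ ?_⟩
      have h1 := mem_tight.1 hj
      have h2 := hv j hj
      rw [mem_tight]
      simp [h1, h2]
    have := vsub_mem_vectorSpan ℝ hf (⟨hx, subset_rfl⟩ : x ∈ tightFace ℓ c (tight ℓ c x))
    rw [vsub_eq_sub, add_sub_cancel_left] at this
    exact (Submodule.smul_mem_iff _ ht.ne').1 this

theorem exists_eq_tightFace {Q : Set V} (hne : Q.Nonempty)
    (hQ : IsExposed ℝ (polyhedron ℓ c) Q) : ∃ T, Realized ℓ c T ∧ tightFace ℓ c T = Q := by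
  obtain ⟨g, hg⟩ := hQ hne
  -- A point with the fewest tight inequalities lies in the relative interior of `Q`.
  obtain ⟨x, hxQ, hmin⟩ : ∃ x ∈ Q, ∀ y ∈ Q, (tight ℓ c x).card ≤ (tight ℓ c y).card := by
    obtain ⟨x, hx, h⟩ := WellFounded.has_min (measure fun y : V ↦ (tight ℓ c y).card).wf Q hne
    exact ⟨x, hx, fun y hy ↦ not_lt.1 (h y hy)⟩
  have hx : x ∈ polyhedron ℓ c := hQ.subset hxQ
  refine ⟨tight ℓ c x, ⟨x, hx, rfl⟩, Set.Subset.antisymm ?_ ?_⟩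
  · rintro y ⟨hy, hsub⟩
    -- Moving from `x` away from `y` stays in the polyhedron; maximality of `g` at `x` then gives `g
    -- x ≤ g y`.
    obtain ⟨t, ht, hm⟩ := exists_add_smul_mem hx (v := x - y) (fun j hj ↦ by
      have h1 := mem_tight.1 hj
      have h2 := mem_tight.1 (hsub hj)
      simp [h1, h2])
    rw [hg] at hxQ ⊢
    have h1 := hxQ.2 _ hm
    simp only [map_add, map_smul, map_sub, smul_eq_mul] at h1
    have h2 : g x ≤ g y := by
      by_contra hlt
      have := mul_pos ht (sub_pos.2 (not_le.1 hlt))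
      linarith
    exact ⟨hy, fun z hz ↦ (hxQ.2 z hz).trans h2⟩
  · intro y hyQ
    have hy : y ∈ polyhedron ℓ c := hQ.subset hyQ
    refine ⟨hy, ?_⟩
    have hconv : Convex ℝ Q := hQ.convex convex_polyhedron
    have hmem : (1 / 2 : ℝ) • x + (1 / 2 : ℝ) • y ∈ Q :=
      hconv hxQ hyQ (by norm_num) (by norm_num) (by norm_num)
    -- The midpoint is tight only where both ends are, so minimality at `x` forces all inequalities
    -- tight at `x` to be tight at `y`.
    have hiff := fun j ↦ tight_midpoint (j := j) hx hy (a := 1 / 2) (b := 1 / 2) (by norm_num)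
      (by norm_num) (by norm_num)
    have heq := Finset.eq_of_subset_of_card_le (fun j hj ↦ ((hiff j).1 hj).1) (hmin _ hmem)
    intro j hj
    rw [← heq] at hj
    exact ((hiff j).1 hj).2

theorem isExposed_tightFace [FiniteDimensional ℝ V] {T : Finset J} (hT : Realized ℓ c T) :
    IsExposed ℝ (polyhedron ℓ c) (tightFace ℓ c T) := by
  obtain ⟨x, hx, hxT⟩ := hT
  intro _
  -- The sum of the functionals in `T` is bounded by the sum of the bounds, with equality exactly
  -- when each of them is tight.
  refine ⟨LinearMap.toContinuousLinearMap (∑ j ∈ T, ℓ j), ?_⟩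
  have hle : ∀ y ∈ polyhedron ℓ c, ∑ j ∈ T, ℓ j y ≤ ∑ j ∈ T, c j := fun y hy ↦
    Finset.sum_le_sum fun j _ ↦ hy j
  have hxe : ∑ j ∈ T, ℓ j x = ∑ j ∈ T, c j :=
    Finset.sum_congr rfl fun j hj ↦ mem_tight.1 (hxT.symm ▸ hj)
  ext y
  simp only [tightFace, Set.mem_ofPred_eq, LinearMap.coe_toContinuousLinearMap',
    LinearMap.sum_apply]
  refine and_congr_right fun hy ↦ ⟨fun h z hz ↦ ?_, fun h j hj ↦ ?_⟩
  · rw [Finset.sum_congr rfl fun j hj ↦ mem_tight.1 (h hj)]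
    exact hle z hz
  · have h1 := (hle y hy).antisymm (hxe ▸ h x hx)
    exact mem_tight.2 ((Finset.sum_eq_sum_iff_of_le fun j _ ↦ hy j).1 h1 j hj)

open Classical in
theorem exposedCount_polyhedron [FiniteDimensional ℝ V] (i : ℕ) :
    exposedCount (polyhedron ℓ c) i =
      (Finset.univ.filter fun T : Finset J ↦
        Realized ℓ c T ∧ Module.finrank ℝ (commonKer ℓ T) = i).card := by
  rw [exposedCount, ← Set.ncard_coe_finset]
  symm
  rw [← Set.InjOn.ncard_image (f := tightFace ℓ c)]
  · congr 1
    ext Q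
    simp only [Finset.coe_filter, Finset.mem_univ, true_and, Set.mem_image, Set.mem_ofPred_eq]
    constructor
    · rintro ⟨T, ⟨hT, hd⟩, rfl⟩
      exact ⟨hT.nonempty_tightFace, isExposed_tightFace hT, by rw [vectorSpan_tightFace hT, hd]⟩
    · rintro ⟨hne, hQ, hd⟩
      obtain ⟨T, hT, rfl⟩ := exists_eq_tightFace hne hQ
      rw [vectorSpan_tightFace hT] at hd
      exact ⟨T, ⟨hT, hd⟩, rfl⟩
  · refine tightFace_injOn.mono ?_
    intro T hT
    simp only [Finset.coe_filter, Finset.mem_univ, true_and, Set.mem_ofPred_eq] at hT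
    exact hT.1

open Classical in
/-- The `f`-polynomial of a polyhedron enumerates the realized sets of tight inequalities. -/
theorem facePoly_polyhedron [FiniteDimensional ℝ V] :
    facePoly (polyhedron ℓ c) =
      ∑ T : Finset J, if Realized ℓ c T then X ^ Module.finrank ℝ (commonKer ℓ T) else 0 := by
  rw [← Finset.sum_filter, facePoly]
  rw [← Finset.sum_fiberwise_of_maps_to
    (g := fun T : Finset J ↦ Module.finrank ℝ (commonKer ℓ T))
    (t := Finset.range (Module.finrank ℝ (vectorSpan ℝ (polyhedron ℓ c)) + 1))]
  · refine Finset.sum_congr rfl fun i _ ↦ ?_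
    rw [exposedCount_polyhedron, Finset.filter_filter,
      Finset.sum_congr rfl (g := fun _ ↦ (X : ℤ[X]) ^ i)]
    · simp
    · intro T hT
      rw [(Finset.mem_filter.1 hT).2.2]
  · intro T hT
    have hT := (Finset.mem_filter.1 hT).2
    rw [Finset.mem_range, Nat.lt_succ_iff, ← vectorSpan_tightFace hT]
    exact Submodule.finrank_mono (vectorSpan_mono ℝ fun y hy ↦ hy.1)

open Classical in
/-- The faces of a polyhedron on which the inequalities in `T₀` are tight, counted on a
parametrization of the affine subspace which these inequalities define. -/
theorem facePoly_preimage {W : Type*} [NormedAddCommGroup W] [NormedSpace ℝ W]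
    [FiniteDimensional ℝ W] (L : W →ₗ[ℝ] V) (v₀ : V) (hL : Function.Injective L) (T₀ : Finset J)
    (htight : ∀ w, ∀ j ∈ T₀, ℓ j (L w + v₀) = c j)
    (hsurj : ∀ x, (∀ j ∈ T₀, ℓ j x = c j) → ∃ w, L w + v₀ = x) :
    facePoly {w | L w + v₀ ∈ polyhedron ℓ c} =
      ∑ T : Finset J with T₀ ⊆ T,
        if Realized ℓ c T then X ^ Module.finrank ℝ (commonKer ℓ T) else 0 := by
  set ℓ' : J → W →ₗ[ℝ] ℝ := fun j ↦ (ℓ j).comp L with hℓ'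
  set c' : J → ℝ := fun j ↦ c j - ℓ j v₀ with hc'
  have hpoly : {w | L w + v₀ ∈ polyhedron ℓ c} = polyhedron ℓ' c' := by
    ext w
    simp [polyhedron, hℓ', hc', le_sub_iff_add_le]
  have htw : ∀ w, tight ℓ' c' w = tight ℓ c (L w + v₀) := by
    intro w
    ext j
    simp [mem_tight, hℓ', hc', eq_sub_iff_add_eq]
  rw [hpoly, facePoly_polyhedron, Finset.sum_filter]
  refine Finset.sum_congr rfl fun T _ ↦ ?_
  by_cases h2 : T₀ ⊆ T
  · rw [if_pos h2]
    have hreal : Realized ℓ' c' T ↔ Realized ℓ c T := by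
      constructor
      · rintro ⟨w, hw, rfl⟩
        rw [← hpoly] at hw
        exact ⟨_, hw, (htw w).symm⟩
      · rintro ⟨x, hx, rfl⟩
        obtain ⟨w, rfl⟩ := hsurj x fun j hj ↦ mem_tight.1 (h2 hj)
        refine ⟨w, ?_, htw w⟩
        rw [← hpoly]
        exact hx
    have hmap : (commonKer ℓ' T).map L = commonKer ℓ T := by
      ext v
      simp only [Submodule.mem_map, mem_commonKer]
      constructor
      · rintro ⟨w, hw, rfl⟩ j hj
        exact hw j hj
      · intro hv
        obtain ⟨w, hw⟩ := hsurj (v + v₀) fun j hj ↦ by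
          have h0 := htight 0 j hj
          have h4 := hv j (h2 hj)
          simp only [map_zero, zero_add] at h0
          simp [h0, h4]
        have hw' : L w = v := add_right_cancel hw
        exact ⟨w, fun j hj ↦ by simp [hℓ', hw', hv j hj], hw'⟩
    simp only [hreal]
    rw [← hmap, (Submodule.equivMapOfInjective L hL _).finrank_eq]
  -- The inequalities in `T₀` are tight at every point of the preimage, so a `T` that misses one of
  -- them is not realized there.
  · rw [if_neg h2, if_neg]
    rintro ⟨w, -, rfl⟩
    refine h2 fun j hj ↦ ?_
    rw [htw, mem_tight]
    exact htight w j hj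

end Polyhedra

/-! ### Products of polyhedra -/

/-- The product of two submodules, as a submodule of the product and as a product of modules. -/
def submoduleProdEquiv {R V₁ V₂ : Type*} [Semiring R] [AddCommMonoid V₁] [AddCommMonoid V₂]
    [Module R V₁] [Module R V₂] (p : Submodule R V₁) (q : Submodule R V₂) :
    (p.prod q) ≃ₗ[R] p × q where
  toFun x := (⟨x.1.1, x.2.1⟩, ⟨x.1.2, x.2.2⟩)
  invFun y := ⟨(y.1, y.2), ⟨y.1.2, y.2.2⟩⟩
  map_add' _ _ := rfl
  map_smul' _ _ := rfl

open Classical in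
/-- The `f`-polynomial is multiplicative on products of polyhedra. -/
theorem facePoly_prod {V₁ V₂ J₁ J₂ : Type*} [NormedAddCommGroup V₁] [NormedSpace ℝ V₁]
    [FiniteDimensional ℝ V₁] [NormedAddCommGroup V₂] [NormedSpace ℝ V₂] [FiniteDimensional ℝ V₂]
    [Fintype J₁] [Fintype J₂] (ℓ₁ : J₁ → V₁ →ₗ[ℝ] ℝ) (c₁ : J₁ → ℝ) (ℓ₂ : J₂ → V₂ →ₗ[ℝ] ℝ)
    (c₂ : J₂ → ℝ) :
    facePoly (polyhedron ℓ₁ c₁ ×ˢ polyhedron ℓ₂ c₂) =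
      facePoly (polyhedron ℓ₁ c₁) * facePoly (polyhedron ℓ₂ c₂) := by
  set ℓ : J₁ ⊕ J₂ → V₁ × V₂ →ₗ[ℝ] ℝ :=
    Sum.elim (fun j ↦ (ℓ₁ j).comp (LinearMap.fst ℝ V₁ V₂))
      (fun j ↦ (ℓ₂ j).comp (LinearMap.snd ℝ V₁ V₂)) with hℓ
  set c : J₁ ⊕ J₂ → ℝ := Sum.elim c₁ c₂ with hc
  have hpoly : polyhedron ℓ₁ c₁ ×ˢ polyhedron ℓ₂ c₂ = polyhedron ℓ c := by
    ext x
    simp [polyhedron, hℓ, hc]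
  have htx : ∀ x y, tight ℓ c (x, y) = (tight ℓ₁ c₁ x).disjSum (tight ℓ₂ c₂ y) := by
    intro x y
    ext j
    rcases j with j | j <;> simp [mem_tight, hℓ, hc]
  rw [hpoly, facePoly_polyhedron, facePoly_polyhedron, facePoly_polyhedron, Finset.sum_mul_sum,
    ← Finset.sum_product', Finset.univ_product_univ]
  refine Fintype.sum_equiv Finset.sumEquiv.toEquiv _ _ fun T ↦ ?_
  obtain ⟨⟨T₁, T₂⟩, rfl⟩ := Finset.sumEquiv.symm.surjective T
  have hreal : Realized ℓ c (T₁.disjSum T₂) ↔ Realized ℓ₁ c₁ T₁ ∧ Realized ℓ₂ c₂ T₂ := by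
    constructor
    · rintro ⟨⟨x, y⟩, hxy, h⟩
      rw [← hpoly] at hxy
      rw [htx, Finset.disjSum_inj] at h
      exact ⟨⟨x, hxy.1, h.1⟩, ⟨y, hxy.2, h.2⟩⟩
    · rintro ⟨⟨x, hx, rfl⟩, ⟨y, hy, rfl⟩⟩
      refine ⟨(x, y), ?_, htx x y⟩
      rw [← hpoly]
      exact ⟨hx, hy⟩
  have hker : commonKer ℓ (T₁.disjSum T₂) = (commonKer ℓ₁ T₁).prod (commonKer ℓ₂ T₂) := by
    ext v
    simp [mem_commonKer, hℓ]
  have hdim : Module.finrank ℝ (commonKer ℓ (T₁.disjSum T₂)) =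
      Module.finrank ℝ (commonKer ℓ₁ T₁) + Module.finrank ℝ (commonKer ℓ₂ T₂) := by
    rw [hker, (submoduleProdEquiv _ _).finrank_eq, Module.finrank_prod]
  rw [RelIso.coe_fn_toEquiv, OrderIso.apply_symm_apply]
  change (if Realized ℓ c (T₁.disjSum T₂) then
    X ^ Module.finrank ℝ (commonKer ℓ (T₁.disjSum T₂)) else 0) = _
  rw [hdim, pow_add]
  by_cases h1 : Realized ℓ₁ c₁ T₁ <;> by_cases h2 : Realized ℓ₂ c₂ T₂ <;> simp [hreal, h1, h2]

end SplitMatroidFaces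

namespace SplitMatroidFaces

/-! ### Inclusion-exclusion for two cuts -/

section Cuts

variable {V : Type*} [NormedAddCommGroup V] [NormedSpace ℝ V] {J : Type*}

/-- The functionals of a system of inequalities enlarged by the functionals `f` and `g`. -/
def cutForm (ℓ : J → V →ₗ[ℝ] ℝ) (f g : V →ₗ[ℝ] ℝ) : J ⊕ Bool → V →ₗ[ℝ] ℝ :=
  Sum.elim ℓ fun b ↦ cond b f g

/-- The bounds of a system of inequalities enlarged by the bounds `p` and `q`. -/
def cutBound (c : J → ℝ) (p q : ℝ) : J ⊕ Bool → ℝ := Sum.elim c fun b ↦ cond b p q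

variable {ℓ : J → V →ₗ[ℝ] ℝ} {c : J → ℝ} {f g : V →ₗ[ℝ] ℝ} {p q : ℝ}

theorem mem_polyhedron_cut {x : V} :
    x ∈ polyhedron (cutForm ℓ f g) (cutBound c p q) ↔ x ∈ polyhedron ℓ c ∧ f x ≤ p ∧ g x ≤ q := by
  simp [mem_polyhedron, cutForm, cutBound, and_comm]

variable [Fintype J]

theorem tight_cut_eq_iff {x : V} {T : Finset (J ⊕ Bool)} :
    tight (cutForm ℓ f g) (cutBound c p q) x = T ↔
      tight ℓ c x = T.toLeft ∧ (f x = p ↔ Sum.inr true ∈ T) ∧ (g x = q ↔ Sum.inr false ∈ T) := by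
  simp [Finset.ext_iff, mem_tight, cutForm, cutBound, and_comm]

theorem realized_cut_iff {T : Finset (J ⊕ Bool)} :
    Realized (cutForm ℓ f g) (cutBound c p q) T ↔
      ∃ x, (x ∈ polyhedron ℓ c ∧ tight ℓ c x = T.toLeft) ∧
        (f x ≤ p ∧ (f x = p ↔ Sum.inr true ∈ T)) ∧ (g x ≤ q ∧ (g x = q ↔ Sum.inr false ∈ T)) := by
  simp only [Realized, mem_polyhedron_cut, tight_cut_eq_iff]
  exact exists_congr fun x ↦ by tauto

/-- This set is a relatively open face; its convexity supplies the connectedness used in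
`exists_lt_and_lt`. -/
theorem convex_tight_eq (D : Finset J) : Convex ℝ {x | x ∈ polyhedron ℓ c ∧ tight ℓ c x = D} := by
  rw [convex_iff_forall_pos]
  rintro x ⟨hx, rfl⟩ y ⟨hy, hxy⟩ a b ha hb hab
  refine ⟨convex_polyhedron hx hy ha.le hb.le hab, ?_⟩
  ext j
  rw [tight_midpoint hx hy ha hb hab, hxy, and_self]

variable [FiniteDimensional ℝ V]

/-- If the parts that two half-spaces cut off from a relatively open face are disjoint, then the
face meets the interior of both half-spaces simultaneously as soon as it meets each of them. -/
theorem exists_lt_and_lt {D : Finset J}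
    (h : ∀ x ∈ polyhedron ℓ c, tight ℓ c x = D → p ≤ f x → q ≤ g x → False) {x y : V}
    (hx : x ∈ polyhedron ℓ c ∧ tight ℓ c x = D) (hfx : f x < p)
    (hy : y ∈ polyhedron ℓ c ∧ tight ℓ c y = D) (hgy : g y < q) :
    ∃ z, (z ∈ polyhedron ℓ c ∧ tight ℓ c z = D) ∧ f z < p ∧ g z < q := by
  by_contra hno
  push Not at hno
  have hpre := (convex_tight_eq (ℓ := ℓ) (c := c) D).isPreconnected
  rw [isPreconnected_closed_iff] at hpre
  -- If no point satisfies both strict inequalities, two closed sets cover a connected set and each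
  -- meets it, so they share a point, against `h`.
  obtain ⟨z, hz, h1, h2⟩ := hpre {z | p ≤ f z} {z | q ≤ g z}
    (isClosed_le continuous_const f.continuous_of_finiteDimensional)
    (isClosed_le continuous_const g.continuous_of_finiteDimensional)
    (fun z hz ↦ (le_or_gt p (f z)).imp id (hno z hz))
    ⟨y, hy, not_lt.1 fun hlt ↦ (hno y hy hlt).not_gt hgy⟩ ⟨x, hx, hno x hx hfx⟩
  exact h z hz.1 hz.2 h1 h2

open Classical in
/-- Inclusion-exclusion for the faces of a polyhedron cut by two half-spaces, where the bounds `p'`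
and `q'` are never attained. -/
theorem realized_cut_add {p' q' : ℝ} (hf : ∀ x ∈ polyhedron ℓ c, f x < p')
    (hg : ∀ x ∈ polyhedron ℓ c, g x < q') {T : Finset (J ⊕ Bool)}
    (h : ∀ x ∈ polyhedron ℓ c, tight ℓ c x = T.toLeft → p ≤ f x → q ≤ g x → False)
    {A : Type*} [AddCommGroup A] (z : A) :
    (if Realized (cutForm ℓ f g) (cutBound c p q) T then z else 0) =
      (if Realized (cutForm ℓ f g) (cutBound c p q') T then z else 0) +
      (if Realized (cutForm ℓ f g) (cutBound c p' q) T then z else 0) -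
      (if Realized (cutForm ℓ f g) (cutBound c p' q') T then z else 0) := by
  simp only [realized_cut_iff]
  set D := T.toLeft
  by_cases h1 : Sum.inr true ∈ T <;> by_cases h2 : Sum.inr false ∈ T <;>
    simp only [h1, h2, iff_true, iff_false]
  -- Both cuts tight: `h` excludes the left-hand side, and unattained bounds exclude the rest.
  · rw [if_neg, if_neg, if_neg, if_neg]
    · simp
    · rintro ⟨x, hx, h3, h4⟩
      exact (hf x hx.1).ne h3.2
    · rintro ⟨x, hx, h3, h4⟩
      exact (hf x hx.1).ne h3.2
    · rintro ⟨x, hx, h3, h4⟩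
      exact (hg x hx.1).ne h4.2
    · rintro ⟨x, hx, h3, h4⟩
      exact h x hx.1 hx.2 h3.2.ge h4.2.ge
  -- Only the first cut tight: then `g x < q` is automatic, so `q` and `q'` impose the same
  -- condition.
  · rw [if_neg (c := ∃ x, _ ∧ (f x ≤ p' ∧ _) ∧ g x ≤ q ∧ _),
      if_neg (c := ∃ x, _ ∧ (f x ≤ p' ∧ _) ∧ g x ≤ q' ∧ _), add_zero, sub_zero]
    · congr 1
      refine propext (exists_congr fun x ↦ and_congr_right fun hx ↦ and_congr_right fun h3 ↦ ?_)
      have h4 : g x < q := not_le.1 (h x hx.1 hx.2 h3.2.ge)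
      simp [h4.le, h4.ne, (hg x hx.1).le, (hg x hx.1).ne]
    · rintro ⟨x, hx, h3, h4⟩
      exact (hf x hx.1).ne h3.2
    · rintro ⟨x, hx, h3, h4⟩
      exact (hf x hx.1).ne h3.2
  · rw [if_neg (c := ∃ x, _ ∧ (f x ≤ p ∧ _) ∧ g x ≤ q' ∧ _),
      if_neg (c := ∃ x, _ ∧ (f x ≤ p' ∧ _) ∧ g x ≤ q' ∧ _), zero_add, sub_zero]
    · congr 1
      refine propext (exists_congr fun x ↦ and_congr_right fun hx ↦ and_congr_left fun h3 ↦ ?_)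
      have h4 : f x < p := not_le.1 fun hle ↦ h x hx.1 hx.2 hle h3.2.ge
      simp [h4.le, h4.ne, (hf x hx.1).le, (hf x hx.1).ne]
    · rintro ⟨x, hx, h3, h4⟩
      exact (hg x hx.1).ne h4.2
    · rintro ⟨x, hx, h3, h4⟩
      exact (hg x hx.1).ne h4.2
  -- No cut tight: all conditions become strict. If the face misses `f < p`, then `h` puts it inside
  -- `g < q`, and the two surviving terms cancel.
  · simp only [← lt_iff_le_and_ne]
    by_cases hD : ∃ x, x ∈ polyhedron ℓ c ∧ tight ℓ c x = D
    · obtain ⟨x, hx⟩ := hD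
      have h0 : ∃ x, (x ∈ polyhedron ℓ c ∧ tight ℓ c x = D) ∧ f x < p' ∧ g x < q' :=
        ⟨x, hx, hf x hx.1, hg x hx.1⟩
      rw [if_pos h0]
      by_cases h3 : ∃ x, (x ∈ polyhedron ℓ c ∧ tight ℓ c x = D) ∧ f x < p ∧ g x < q'
      · by_cases h4 : ∃ x, (x ∈ polyhedron ℓ c ∧ tight ℓ c x = D) ∧ f x < p' ∧ g x < q
        · rw [if_pos h3, if_pos h4, if_pos]
          · simp
          · obtain ⟨x, hx, hfx, -⟩ := h3
            obtain ⟨y, hy, -, hgy⟩ := h4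
            exact exists_lt_and_lt h hx hfx hy hgy
        · rw [if_pos h3, if_neg h4, if_neg]
          · simp
          · rintro ⟨x, hx, hfx, hgx⟩
            exact h4 ⟨x, hx, hf x hx.1, hgx⟩
      · have hfx : p ≤ f x := not_lt.1 fun hlt ↦ h3 ⟨x, hx, hlt, hg x hx.1⟩
        have hgx : g x < q := not_le.1 (h x hx.1 hx.2 hfx)
        have h4 : ∃ x, (x ∈ polyhedron ℓ c ∧ tight ℓ c x = D) ∧ f x < p' ∧ g x < q :=
          ⟨x, hx, hf x hx.1, hgx⟩
        rw [if_neg h3, if_pos h4, if_neg]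
        · simp
        · rintro ⟨x, hx, hfx, hgx⟩
          exact h3 ⟨x, hx, hfx, hg x hx.1⟩
    · have hn : ∀ P : V → Prop, ¬ ∃ x, (x ∈ polyhedron ℓ c ∧ tight ℓ c x = D) ∧ P x :=
        fun P ⟨x, hx, _⟩ ↦ hD ⟨x, hx⟩
      simp only [if_neg (hn _)]
      simp

end Cuts

end SplitMatroidFaces

namespace SplitMatroidFaces

/-! ### Extreme points of polyhedra -/

section Extreme

variable {V : Type*} [NormedAddCommGroup V] [NormedSpace ℝ V] {J : Type*}
  {ℓ : J → V →ₗ[ℝ] ℝ} {c : J → ℝ}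

theorem commonKer_tight_of_mem_extremePoints [Fintype J] {x v : V}
    (hx : x ∈ (polyhedron ℓ c).extremePoints ℝ) (hv : v ∈ commonKer ℓ (tight ℓ c x)) : v = 0 := by
  have h1 := eventually_add_smul_mem hx.1 (v := v) fun j hj ↦ (hv j hj).le
  have h2 := eventually_add_smul_mem hx.1 (v := -v) fun j hj ↦ by simp [hv j hj]
  obtain ⟨t, ⟨h1, h2⟩, ht⟩ := ((h1.and h2).and self_mem_nhdsWithin).exists
  have h3 := (mem_extremePoints.1 hx).2 _ h1 _ h2
    ⟨1 / 2, 1 / 2, by norm_num, by norm_num, by norm_num, by module⟩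
  have h4 : t • v = 0 := by simpa using h3.1
  exact (smul_eq_zero.1 h4).resolve_left (ne_of_gt ht)

theorem isClosed_polyhedron [FiniteDimensional ℝ V] : IsClosed (polyhedron ℓ c) := by
  have : polyhedron ℓ c = ⋂ j, {x | ℓ j x ≤ c j} := by
    ext x
    simp [mem_polyhedron]
  rw [this]
  exact isClosed_iInter fun j ↦
    isClosed_le (ℓ j).continuous_of_finiteDimensional continuous_const

end Extreme

/-! ### Integrality of the doubly cut hypersimplex -/

section Slices

variable {n : ℕ}

/-- The linear functional which sums the coordinates in `F`. -/
noncomputable def coordSum (F : Finset (Fin n)) : (Fin n → ℝ) →ₗ[ℝ] ℝ :=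
  ∑ i ∈ F, LinearMap.proj i

@[simp]
theorem coordSum_apply (F : Finset (Fin n)) (x : Fin n → ℝ) : coordSum F x = ∑ i ∈ F, x i := by
  simp [coordSum]

/-- The functionals of the inequalities `0 ≤ x i ≤ 1` and `k ≤ ∑ i, x i ≤ k`. -/
noncomputable def hypersimplexForm (n : ℕ) :
    (Fin n ⊕ Fin n) ⊕ Bool → (Fin n → ℝ) →ₗ[ℝ] ℝ :=
  cutForm (Sum.elim (fun i ↦ -LinearMap.proj i) fun i ↦ LinearMap.proj i)
    (coordSum Finset.univ) (-coordSum Finset.univ)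

/-- The bounds of the inequalities `0 ≤ x i ≤ 1` and `k ≤ ∑ i, x i ≤ k`. -/
def hypersimplexBound (k n : ℕ) : (Fin n ⊕ Fin n) ⊕ Bool → ℝ :=
  cutBound (Sum.elim (fun _ ↦ 0) fun _ ↦ 1) k (-k)

theorem mem_polyhedron_hypersimplex {k : ℕ} {x : Fin n → ℝ} :
    x ∈ polyhedron (hypersimplexForm n) (hypersimplexBound k n) ↔
      (∀ i, 0 ≤ x i ∧ x i ≤ 1) ∧ ∑ i, x i = k := by
  rw [hypersimplexForm, hypersimplexBound, mem_polyhedron_cut]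
  simp only [mem_polyhedron, Sum.forall, Sum.elim_inl, Sum.elim_inr, LinearMap.neg_apply,
    LinearMap.proj_apply, coordSum_apply, neg_le_neg_iff, Left.neg_nonpos_iff, forall_and]
  exact and_congr_right fun _ ↦ ⟨fun h ↦ h.1.antisymm h.2, fun h ↦ ⟨h.le, h.ge⟩⟩

/-- The part of the hypersimplex where the coordinates in `F` sum to at most `p` and those in `G`
to at most `q`. -/
def hypersimplexSlice (k : ℕ) (F G : Finset (Fin n)) (p q : ℝ) : Set (Fin n → ℝ) :=
  polyhedron (cutForm (hypersimplexForm n) (coordSum F) (coordSum G))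
    (cutBound (hypersimplexBound k n) p q)

theorem mem_hypersimplexSlice {k : ℕ} {F G : Finset (Fin n)} {p q : ℝ} {x : Fin n → ℝ} :
    x ∈ hypersimplexSlice k F G p q ↔
      ((∀ i, 0 ≤ x i ∧ x i ≤ 1) ∧ ∑ i, x i = k) ∧ ∑ i ∈ F, x i ≤ p ∧ ∑ i ∈ G, x i ≤ q := by
  rw [hypersimplexSlice, mem_polyhedron_cut, mem_polyhedron_hypersimplex, coordSum_apply,
    coordSum_apply]

/-- A single fractional coordinate in `S` would be an integer strictly between `0` and `1`. -/
theorem exists_ne_fractional {x : Fin n → ℝ} (hx : ∀ i, 0 ≤ x i ∧ x i ≤ 1) {S : Finset (Fin n)}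
    {m : ℤ} (hS : ∑ i ∈ S, x i = m) {i : Fin n} (hi : i ∈ S) (h0 : x i ≠ 0) (h1 : x i ≠ 1) :
    ∃ j ∈ S, i ≠ j ∧ x j ≠ 0 ∧ x j ≠ 1 := by
  by_contra hno
  push Not at hno
  have hsum : ∑ j ∈ S.erase i, x j = (((S.erase i).filter fun j ↦ x j = 1).card : ℝ) := by
    rw [← Finset.sum_boole]
    refine Finset.sum_congr rfl fun j hj ↦ ?_
    split_ifs with h
    · exact h
    · by_contra hj0
      exact h (hno j (Finset.mem_of_mem_erase hj) (Finset.ne_of_mem_erase hj).symm hj0)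
  rw [← Finset.add_sum_erase S x hi, hsum] at hS
  set N := ((S.erase i).filter fun j ↦ x j = 1).card
  have h2 : x i = ((m - N : ℤ) : ℝ) := by
    push_cast
    linarith
  have h3 : (0 : ℝ) < ((m - N : ℤ) : ℝ) := h2 ▸ lt_of_le_of_ne (hx i).1 h0.symm
  have h4 : ((m - N : ℤ) : ℝ) < ((1 : ℤ) : ℝ) := by
    rw [← h2, Int.cast_one]
    exact lt_of_le_of_ne (hx i).2 h1
  rw [Int.cast_pos] at h3
  rw [Int.cast_lt] at h4
  omega

/-- If a tight cut has a fractional coordinate outside its index set, the complement has integral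
sum and contains a second one; both lie in the other index set because the two cover. Otherwise
every tight cut contains all fractional coordinates, and any two will do. -/
theorem exists_fractional_pair {x : Fin n → ℝ} (hx : ∀ i, 0 ≤ x i ∧ x i ≤ 1)
    {F G : Finset (Fin n)} (hFG : F ∪ G = Finset.univ) {k p q : ℕ} (hk : ∑ i, x i = k)
    {i₀ : Fin n} (h0 : x i₀ ≠ 0) (h1 : x i₀ ≠ 1) :
    ∃ i j, i ≠ j ∧ (x i ≠ 0 ∧ x i ≠ 1) ∧ (x j ≠ 0 ∧ x j ≠ 1) ∧
      (∑ i ∈ F, x i = p → (i ∈ F ↔ j ∈ F)) ∧ (∑ i ∈ G, x i = q → (i ∈ G ↔ j ∈ G)) := by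
  have hmem : ∀ i, i ∉ F → i ∈ G := fun i hi ↦
    (Finset.mem_union.1 (hFG ▸ Finset.mem_univ i)).resolve_left hi
  have hcompl : ∀ (S : Finset (Fin n)) (r : ℕ), ∑ i ∈ S, x i = r →
      ∑ i ∈ Sᶜ, x i = ((k - r : ℤ) : ℝ) := by
    intro S r hr
    have := Finset.sum_add_sum_compl S x
    push_cast
    linarith
  by_cases hF : ∑ i ∈ F, x i = p ∧ ∃ i ∈ Fᶜ, x i ≠ 0 ∧ x i ≠ 1
  · obtain ⟨hF, i, hi, hi0, hi1⟩ := hF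
    obtain ⟨j, hj, hij, hj0, hj1⟩ := exists_ne_fractional hx (hcompl F p hF) hi hi0 hi1
    rw [Finset.mem_compl] at hi hj
    exact ⟨i, j, hij, ⟨hi0, hi1⟩, ⟨hj0, hj1⟩, fun _ ↦ iff_of_false hi hj,
      fun _ ↦ iff_of_true (hmem i hi) (hmem j hj)⟩
  by_cases hG : ∑ i ∈ G, x i = q ∧ ∃ i ∈ Gᶜ, x i ≠ 0 ∧ x i ≠ 1
  · obtain ⟨hG, i, hi, hi0, hi1⟩ := hG
    obtain ⟨j, hj, hij, hj0, hj1⟩ := exists_ne_fractional hx (hcompl G q hG) hi hi0 hi1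
    rw [Finset.mem_compl] at hi hj
    exact ⟨i, j, hij, ⟨hi0, hi1⟩, ⟨hj0, hj1⟩,
      fun _ ↦ iff_of_true (by_contra fun h ↦ hi (hmem i h)) (by_contra fun h ↦ hj (hmem j h)),
      fun _ ↦ iff_of_false hi hj⟩
  obtain ⟨j₀, -, hij, hj0, hj1⟩ := exists_ne_fractional hx (m := k) (by simpa using hk)
    (Finset.mem_univ i₀) h0 h1
  push Not at hF hG
  have hF' : ∑ i ∈ F, x i = p → ∀ i, x i ≠ 0 → x i ≠ 1 → i ∈ F := fun h i hi0 hi1 ↦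
    by_contra fun hi ↦ hi1 (hF h i (Finset.mem_compl.2 hi) hi0)
  have hG' : ∑ i ∈ G, x i = q → ∀ i, x i ≠ 0 → x i ≠ 1 → i ∈ G := fun h i hi0 hi1 ↦
    by_contra fun hi ↦ hi1 (hG h i (Finset.mem_compl.2 hi) hi0)
  exact ⟨i₀, j₀, hij, ⟨h0, h1⟩, ⟨hj0, hj1⟩,
    fun h ↦ iff_of_true (hF' h _ h0 h1) (hF' h _ hj0 hj1),
    fun h ↦ iff_of_true (hG' h _ h0 h1) (hG' h _ hj0 hj1)⟩

theorem sum_single_sub_single {i j : Fin n} {S : Finset (Fin n)} (h : i ∈ S ↔ j ∈ S) :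
    ∑ l ∈ S, (Pi.single i (1 : ℝ) - Pi.single j 1 : Fin n → ℝ) l = 0 := by
  simp [Finset.sum_sub_distrib, h]

theorem extremePoints_hypersimplexSlice {k p q : ℕ} {F G : Finset (Fin n)}
    (hFG : F ∪ G = Finset.univ) {x : Fin n → ℝ}
    (hx : x ∈ (hypersimplexSlice k F G p q).extremePoints ℝ) (i : Fin n) : x i = 0 ∨ x i = 1 := by
  by_contra! hi
  obtain ⟨⟨hbox, hk⟩, -, -⟩ := mem_hypersimplexSlice.1 hx.1
  obtain ⟨i, j, hij, hi, hj, hF, hG⟩ :=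
    exists_fractional_pair hbox hFG (p := p) (q := q) hk hi.1 hi.2
  -- Shifting mass from `j` to `i` preserves every tight constraint, which is impossible at an
  -- extreme point.
  have hv := commonKer_tight_of_mem_extremePoints hx
    (v := (Pi.single i (1 : ℝ) - Pi.single j 1 : Fin n → ℝ)) ?_
  · have := congr_fun hv i
    simp [hij] at this
  · intro l hl
    rw [mem_tight] at hl
    have hcoord : ∀ l, x l = 0 ∨ x l = 1 →
        (Pi.single i (1 : ℝ) - Pi.single j 1 : Fin n → ℝ) l = 0 := by
      intro l hl
      have h1 : l ≠ i := by
        rintro rfl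
        exact hl.elim hi.1 hi.2
      have h2 : l ≠ j := by
        rintro rfl
        exact hl.elim hj.1 hj.2
      simp [h1, h2]
    rcases l with ((l | l) | (_ | _)) | (_ | _)
    · have hl : -x l = 0 := hl
      have := hcoord l (.inl (neg_eq_zero.1 hl))
      exact neg_eq_zero.2 this
    · exact hcoord l (.inr hl)
    · refine neg_eq_zero.2 ?_
      rw [coordSum_apply]
      exact sum_single_sub_single
        (iff_of_true (Finset.mem_univ _) (Finset.mem_univ _))
    · exact (coordSum_apply _ _).trans (sum_single_sub_single
        (iff_of_true (Finset.mem_univ _) (Finset.mem_univ _)))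
    · exact (coordSum_apply _ _).trans (sum_single_sub_single
        (hG ((coordSum_apply _ _).symm.trans hl)))
    · exact (coordSum_apply _ _).trans (sum_single_sub_single
        (hF ((coordSum_apply _ _).symm.trans hl)))

theorem sum_indicator_one (B S : Finset (Fin n)) :
    ∑ i ∈ S, (B : Set (Fin n)).indicator (1 : Fin n → ℝ) i = ((B ∩ S).card : ℝ) := by
  simp [Set.indicator_apply, Finset.inter_comm]

/-- The integrality theorem for the hypersimplex cut by two half-spaces whose index sets cover the
ground set. -/
theorem hypersimplexSlice_eq_convexHull {k p q : ℕ} {F G : Finset (Fin n)}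
    (hFG : F ∪ G = Finset.univ) :
    hypersimplexSlice k F G p q =
      convexHull ℝ ((fun B : Finset (Fin n) ↦ (B : Set (Fin n)).indicator 1) ''
        {B | B.card = k ∧ (B ∩ F).card ≤ p ∧ (B ∩ G).card ≤ q}) := by
  have hmem : ∀ B : Finset (Fin n), (B : Set (Fin n)).indicator 1 ∈ hypersimplexSlice k F G p q ↔
      B.card = k ∧ (B ∩ F).card ≤ p ∧ (B ∩ G).card ≤ q := by
    intro B
    rw [mem_hypersimplexSlice, sum_indicator_one, sum_indicator_one, sum_indicator_one,
      Finset.inter_univ, Nat.cast_inj, Nat.cast_le, Nat.cast_le, and_assoc, and_iff_right]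
    intro i
    by_cases hi : i ∈ B <;> simp [hi]
  set E := (fun B : Finset (Fin n) ↦ (B : Set (Fin n)).indicator (1 : Fin n → ℝ)) ''
        {B | B.card = k ∧ (B ∩ F).card ≤ p ∧ (B ∩ G).card ≤ q} with hE
  apply Set.Subset.antisymm
  · have hcpt : IsCompact (hypersimplexSlice k F G p q) := by
      refine (isCompact_Icc (a := (0 : Fin n → ℝ)) (b := 1)).of_isClosed_subset
        isClosed_polyhedron fun x hx ↦ ?_
      have := (mem_hypersimplexSlice.1 hx).1.1
      exact ⟨fun i ↦ (this i).1, fun i ↦ (this i).2⟩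
    have hfin : E.Finite := (Set.toFinite _).image _
    rw [← closure_convexHull_extremePoints hcpt convex_polyhedron]
    refine closure_minimal (convexHull_mono fun x hx ↦ ?_) (hfin.isClosed_convexHull ℝ)
    have h01 := extremePoints_hypersimplexSlice hFG hx
    have hxB : ((Finset.univ.filter fun i ↦ x i = 1 : Finset (Fin n)) : Set (Fin n)).indicator 1
        = x := by
      ext i
      rcases h01 i with h | h <;> simp [h]
    refine ⟨Finset.univ.filter fun i ↦ x i = 1, (hmem _).1 ?_, hxB⟩
    rw [hxB]
    exact hx.1
  · refine convexHull_min ?_ convex_polyhedron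
    rintro _ ⟨B, hB, rfl⟩
    exact (hmem B).2 hB

theorem mem_hypersimplex {k : ℕ} {x : Fin n → ℝ} :
    x ∈ hypersimplex k n ↔ (∀ i, 0 ≤ x i ∧ x i ≤ 1) ∧ ∑ i, x i = k := by
  have h : hypersimplex k n = hypersimplexSlice k Finset.univ Finset.univ k k := by
    rw [hypersimplexSlice_eq_convexHull (by simp), hypersimplex]
    congr 2
    ext B
    simp +contextual
  rw [h, mem_hypersimplexSlice, and_iff_left_of_imp]
  rintro ⟨-, h⟩
  exact ⟨h.le, h.le⟩

theorem hypersimplex_eq_polyhedron (k n : ℕ) :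
    hypersimplex k n = polyhedron (hypersimplexForm n) (hypersimplexBound k n) := by
  ext x
  rw [mem_hypersimplex, mem_polyhedron_hypersimplex]

/-- This makes `k + 1` a bound for an absent cut: it removes nothing and is never tight. -/
theorem coordSum_lt {k : ℕ} {x : Fin n → ℝ}
    (hx : x ∈ polyhedron (hypersimplexForm n) (hypersimplexBound k n)) (S : Finset (Fin n)) :
    coordSum S x < k + 1 := by
  obtain ⟨h1, h2⟩ := mem_polyhedron_hypersimplex.1 hx
  have := Finset.sum_le_sum_of_subset_of_nonneg (Finset.subset_univ S) fun i _ _ ↦ (h1 i).1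
  rw [coordSum_apply]
  linarith

theorem schubertPolytope_eq_slice_left (k r : ℕ) (F G : Finset (Fin n)) :
    schubertPolytope k F r = hypersimplexSlice k F G r (k + 1) := by
  ext x
  rw [hypersimplexSlice, mem_polyhedron_cut, ← hypersimplex_eq_polyhedron]
  refine and_congr_right fun hx ↦ ?_
  rw [hypersimplex_eq_polyhedron] at hx
  rw [and_iff_left (coordSum_lt hx G).le, coordSum_apply]

theorem schubertPolytope_eq_slice_right (k r : ℕ) (F G : Finset (Fin n)) :
    schubertPolytope k G r = hypersimplexSlice k F G (k + 1) r := by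
  ext x
  rw [hypersimplexSlice, mem_polyhedron_cut, ← hypersimplex_eq_polyhedron]
  refine and_congr_right fun hx ↦ ?_
  rw [hypersimplex_eq_polyhedron] at hx
  rw [and_iff_right (coordSum_lt hx F).le, coordSum_apply]

theorem hypersimplex_eq_slice (k : ℕ) (F G : Finset (Fin n)) :
    hypersimplex k n = hypersimplexSlice k F G (k + 1) (k + 1) := by
  ext x
  rw [hypersimplexSlice, mem_polyhedron_cut, ← hypersimplex_eq_polyhedron, iff_self_and]
  intro hx
  rw [hypersimplex_eq_polyhedron] at hx
  exact ⟨(coordSum_lt hx F).le, (coordSum_lt hx G).le⟩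

end Slices

end SplitMatroidFaces

/-! ### Matroids with four cyclic flats -/

theorem Matroid.IsCircuit.isCyclicFlat_closure {α : Type*} {M : Matroid α} {C : Set α}
    (hC : M.IsCircuit C) : M.IsCyclicFlat (M.closure C) := by
  refine ⟨M.isFlat_closure C, fun e he ↦ ?_⟩
  by_cases heC : e ∈ C
  · exact ⟨C, hC, heC, M.subset_closure C hC.subset_ground⟩
  · obtain ⟨D, hDC, hD, heD⟩ := Matroid.exists_isCircuit_of_mem_closure he heC
    exact ⟨D, hD, heD, hDC.trans
      (Set.insert_subset he (M.subset_closure C hC.subset_ground))⟩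

namespace SplitMatroidFaces

section FourCyclicFlats

variable {n k rF rG : ℕ} {N : Matroid (Fin n)} {F G : Finset (Fin n)}

theorem circuit_closure_cases
    (hcyc : {Z : Set (Fin n) | N.IsCyclicFlat Z} =
      {(∅ : Set (Fin n)), (F : Set (Fin n)), (G : Set (Fin n)), (Set.univ : Set (Fin n))})
    {C : Set (Fin n)} (hC : N.IsCircuit C) :
    N.closure C = F ∨ N.closure C = G ∨ N.closure C = Set.univ := by
  have h : N.closure C ∈ {Z : Set (Fin n) | N.IsCyclicFlat Z} := hC.isCyclicFlat_closure
  rw [hcyc] at h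
  refine h.resolve_left fun h0 ↦ ?_
  have := N.subset_closure C hC.subset_ground
  rw [h0, Set.subset_empty_iff] at this
  exact hC.nonempty.ne_empty this

theorem not_subset_of_four
    (hcyc : {Z : Set (Fin n) | N.IsCyclicFlat Z} =
      {(∅ : Set (Fin n)), (F : Set (Fin n)), (G : Set (Fin n)), (Set.univ : Set (Fin n))})
    (hfour : {Z : Set (Fin n) | N.IsCyclicFlat Z}.ncard = 4)
    (hFG : F ∪ G = Finset.univ) : ¬ F ⊆ G ∧ ¬ G ⊆ F := by
  have key : ∀ a b c : Set (Fin n), ({a, b, c} : Set (Set (Fin n))).ncard ≤ 3 := fun a b c ↦ by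
    refine (Set.ncard_insert_le _ _).trans ?_
    have := Set.ncard_insert_le b {c}
    rw [Set.ncard_singleton] at this
    omega
  rw [hcyc] at hfour
  constructor
  · intro h
    rw [Finset.union_eq_right.2 h] at hFG
    rw [hFG, Finset.coe_univ, Set.pair_eq_singleton] at hfour
    have := key ∅ F Set.univ
    omega
  · intro h
    rw [Finset.union_eq_left.2 h] at hFG
    rw [hFG, Finset.coe_univ, Set.pair_comm (G : Set (Fin n)), Set.insert_idem] at hfour
    have := key ∅ Set.univ G
    omega

/-- A circuit inside `F ∩ G` would have its closure in both flats; that closure is `F`, `G` or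
everything, so one flat would contain the other. -/
theorem indep_inter
    (hE : N.E = Set.univ)
    (hcyc : {Z : Set (Fin n) | N.IsCyclicFlat Z} =
      {(∅ : Set (Fin n)), (F : Set (Fin n)), (G : Set (Fin n)), (Set.univ : Set (Fin n))})
    (hfour : {Z : Set (Fin n) | N.IsCyclicFlat Z}.ncard = 4)
    (hFG : F ∪ G = Finset.univ) : N.Indep ((F ∩ G : Finset (Fin n)) : Set (Fin n)) := by
  obtain ⟨hn1, hn2⟩ := not_subset_of_four hcyc hfour hFG
  have hF : N.IsCyclicFlat (F : Set (Fin n)) := by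
    have : (F : Set (Fin n)) ∈ {Z : Set (Fin n) | N.IsCyclicFlat Z} := by simp [hcyc]
    exact this
  have hG : N.IsCyclicFlat (G : Set (Fin n)) := by
    have : (G : Set (Fin n)) ∈ {Z : Set (Fin n) | N.IsCyclicFlat Z} := by simp [hcyc]
    exact this
  by_contra hdep
  rw [Matroid.not_indep_iff (by simp [hE])] at hdep
  obtain ⟨C, hCs, hC⟩ := hdep.exists_isCircuit_subset
  rw [Finset.coe_inter, Set.subset_inter_iff] at hCs
  have h1 : N.closure C ⊆ F := hF.1.closure ▸ N.closure_subset_closure hCs.1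
  have h2 : N.closure C ⊆ G := hG.1.closure ▸ N.closure_subset_closure hCs.2
  rcases circuit_closure_cases hcyc hC with h | h | h
  · rw [h] at h2
    exact hn1 (Finset.coe_subset.1 h2)
  · rw [h] at h1
    exact hn2 (Finset.coe_subset.1 h1)
  · rw [h] at h2
    exact hn1 (Finset.coe_subset.1 ((Set.subset_univ _).trans h2))

/-- Submodularity of the rank function, with `F ∩ G` independent. -/
theorem card_inter_add_le (hE : N.E = Set.univ)
    (hind : N.Indep ((F ∩ G : Finset (Fin n)) : Set (Fin n)))
    (hFG : F ∪ G = Finset.univ) (hk : N.eRank = (k : ℕ∞))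
    (hrF : N.eRk (F : Set (Fin n)) = (rF : ℕ∞)) (hrG : N.eRk (G : Set (Fin n)) = (rG : ℕ∞)) :
    (F ∩ G).card + k ≤ rF + rG := by
  have h := N.eRk_inter_add_eRk_union_le F G
  rw [← Finset.coe_inter, ← Finset.coe_union, hFG, Finset.coe_univ, hind.eRk_eq_encard,
    Set.encard_coe_eq_coe_finsetCard, hrF, hrG, ← hE, N.eRk_ground, hk] at h
  exact_mod_cast h

theorem card_le_of_indep {I : Finset (Fin n)} {S : Set (Fin n)} {r : ℕ}
    (hI : N.Indep (I : Set (Fin n))) (hS : (I : Set (Fin n)) ⊆ S) (hr : N.eRk S = (r : ℕ∞)) : I.card ≤ r := by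
  have h := hI.encard_le_eRk_of_subset hS
  rw [hr, Set.encard_coe_eq_coe_finsetCard] at h
  exact_mod_cast h

theorem isBase_iff_card (hE : N.E = Set.univ)
    (hcyc : {Z : Set (Fin n) | N.IsCyclicFlat Z} =
      {(∅ : Set (Fin n)), (F : Set (Fin n)), (G : Set (Fin n)), (Set.univ : Set (Fin n))})
    (hk : N.eRank = (k : ℕ∞))
    (hrF : N.eRk (F : Set (Fin n)) = (rF : ℕ∞)) (hrG : N.eRk (G : Set (Fin n)) = (rG : ℕ∞))
    (B : Finset (Fin n)) :
    N.IsBase (B : Set (Fin n)) ↔ B.card = k ∧ (B ∩ F).card ≤ rF ∧ (B ∩ G).card ≤ rG := by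
  constructor
  · intro hB
    have h := hB.encard_eq_eRank
    rw [hk, Set.encard_coe_eq_coe_finsetCard] at h
    refine ⟨by exact_mod_cast h, ?_, ?_⟩
    · exact card_le_of_indep (hB.indep.subset (by simp)) (by simp) hrF
    · exact card_le_of_indep (hB.indep.subset (by simp)) (by simp) hrG
  · rintro ⟨h1, h2, h3⟩
    -- A circuit spanning `Z` has one element more than the rank of `Z`, and all of it lies in `B ∩
    -- Z`.
    have hlt : ∀ (Z : Finset (Fin n)) (r : ℕ) (C : Set (Fin n)), N.IsCircuit C → C ⊆ B →
        N.closure C = Z → N.eRk Z = (r : ℕ∞) → r < (B ∩ Z).card := by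
      intro Z r C hC hCB hZ hr
      have h := hC.eRk_add_one_eq
      have hsub : C ⊆ ((B ∩ Z : Finset (Fin n)) : Set (Fin n)) := by
        rw [Finset.coe_inter, ← hZ]
        exact Set.subset_inter hCB (N.subset_closure C hC.subset_ground)
      have h4 := Set.encard_le_encard hsub
      rw [← h, ← N.eRk_closure_eq, hZ, hr, Set.encard_coe_eq_coe_finsetCard] at h4
      exact_mod_cast h4
    have hind : N.Indep (B : Set (Fin n)) := by
      by_contra hdep
      rw [Matroid.not_indep_iff (by simp [hE])] at hdep
      obtain ⟨C, hCB, hC⟩ := hdep.exists_isCircuit_subset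
      rcases circuit_closure_cases hcyc hC with h | h | h
      · exact (hlt F rF C hC hCB h hrF).not_ge h2
      · exact (hlt G rG C hC hCB h hrG).not_ge h3
      · have := hlt Finset.univ k C hC hCB (by simpa using h)
          (by rw [Finset.coe_univ, ← hE, N.eRk_ground, hk])
        rw [Finset.inter_univ] at this
        omega
    refine hind.isBase_of_eRk_ge B.finite_toSet ?_
    rw [hind.eRk_eq_encard, hk, Set.encard_coe_eq_coe_finsetCard, h1]

theorem basePolytope_eq_slice (hE : N.E = Set.univ)
    (hcyc : {Z : Set (Fin n) | N.IsCyclicFlat Z} =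
      {(∅ : Set (Fin n)), (F : Set (Fin n)), (G : Set (Fin n)), (Set.univ : Set (Fin n))})
    (hFG : F ∪ G = Finset.univ) (hk : N.eRank = (k : ℕ∞))
    (hrF : N.eRk (F : Set (Fin n)) = (rF : ℕ∞)) (hrG : N.eRk (G : Set (Fin n)) = (rG : ℕ∞)) :
    basePolytope N = hypersimplexSlice k F G rF rG := by
  rw [hypersimplexSlice_eq_convexHull hFG, basePolytope]
  congr 1
  ext x
  constructor
  · rintro ⟨B, hB, rfl⟩
    obtain ⟨B, rfl⟩ := B.toFinite.exists_finset_coe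
    exact ⟨B, (isBase_iff_card hE hcyc hk hrF hrG B).1 hB, rfl⟩
  · rintro ⟨B, hB, rfl⟩
    exact ⟨B, (isBase_iff_card hE hcyc hk hrF hrG B).2 hB, rfl⟩

end FourCyclicFlats

end SplitMatroidFaces

namespace SplitMatroidFaces

/-! ### Faces on which prescribed coordinates equal one -/

section Restriction

variable {n k : ℕ} {F G : Finset (Fin n)} {p q : ℝ}

/-- The inequalities `x i ≤ 1` for `i ∈ I`. -/
def upperIndices (I : Finset (Fin n)) : Finset (((Fin n ⊕ Fin n) ⊕ Bool) ⊕ Bool) :=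
  I.map ⟨fun i ↦ Sum.inl (Sum.inl (Sum.inr i)), fun i j h ↦ by simpa using h⟩

open Classical in
/-- The term of the `f`-polynomial of a slice of the hypersimplex that belongs to a set of tight
inequalities. -/
noncomputable def sliceTerm (k : ℕ) (F G : Finset (Fin n)) (p q : ℝ)
    (T : Finset (((Fin n ⊕ Fin n) ⊕ Bool) ⊕ Bool)) : ℤ[X] :=
  if Realized (cutForm (hypersimplexForm n) (coordSum F) (coordSum G))
    (cutBound (hypersimplexBound k n) p q) T
  then X ^ Module.finrank ℝ
    (commonKer (cutForm (hypersimplexForm n) (coordSum F) (coordSum G)) T) else 0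

theorem facePoly_slice : facePoly (hypersimplexSlice k F G p q) = ∑ T, sliceTerm k F G p q T :=
  facePoly_polyhedron

theorem facePoly_slice_eq_add (I : Finset (Fin n)) : facePoly (hypersimplexSlice k F G p q) =
    ∑ T with upperIndices I ⊆ T, sliceTerm k F G p q T +
      ∑ T with ¬ upperIndices I ⊆ T, sliceTerm k F G p q T := by
  rw [facePoly_slice, Finset.sum_filter_add_sum_filter_not]

theorem upperIndices_tight_iff {I : Finset (Fin n)} {x : Fin n → ℝ} :
    (∀ j ∈ upperIndices I, cutForm (hypersimplexForm n) (coordSum F) (coordSum G) j x =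
      cutBound (hypersimplexBound k n) p q j) ↔ ∀ i ∈ I, x i = 1 := by
  simp only [upperIndices, Finset.mem_map, forall_exists_index, and_imp,
    forall_apply_eq_imp_iff₂]
  rfl

/-- The faces of a slice on which the coordinates in `I` are `1` are the faces of its preimage
under a parametrization of the subspace where these coordinates are `1`. -/
theorem facePoly_slice_preimage {W : Type*} [NormedAddCommGroup W] [NormedSpace ℝ W]
    [FiniteDimensional ℝ W] (L : W →ₗ[ℝ] Fin n → ℝ) (hL : Function.Injective L)
    {I : Finset (Fin n)} (h0 : ∀ w, ∀ i ∈ I, L w i = 0)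
    (hsurj : ∀ v : Fin n → ℝ, (∀ i ∈ I, v i = 0) → ∃ w, L w = v) :
    facePoly {w | L w + (I : Set (Fin n)).indicator (1 : Fin n → ℝ) ∈ hypersimplexSlice k F G p q} =
      ∑ T with upperIndices I ⊆ T, sliceTerm k F G p q T := by
  refine (facePoly_preimage (ℓ := cutForm (hypersimplexForm n) (coordSum F) (coordSum G))
    (c := cutBound (hypersimplexBound k n) p q) L _ hL (upperIndices I) (fun w ↦ ?_)
    fun x hx ↦ ?_).trans (Finset.sum_congr (by ext; simp) fun _ _ ↦ rfl)
  · rw [upperIndices_tight_iff]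
    intro i hi
    simp [h0 w i hi, hi]
  · rw [upperIndices_tight_iff] at hx
    obtain ⟨w, hw⟩ := hsurj (x - (I : Set (Fin n)).indicator (1 : Fin n → ℝ))
      fun i hi ↦ by simp [hx i hi, hi]
    exact ⟨w, by rw [hw, sub_add_cancel]⟩

end Restriction

/-! ### Extending points by ones -/

section Extension

variable {n k : ℕ} {ι : Type*} {e : ι → Fin n} {I : Finset (Fin n)}

theorem extend_zero_of_mem (hI : ∀ s, e s ∉ I) (w : ι → ℝ) {i : Fin n} (hi : i ∈ I) :
    Function.extend e w 0 i = 0 :=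
  Function.extend_apply' _ _ _ fun ⟨s, hs⟩ ↦ hI s (hs ▸ hi)

theorem exists_extend_eq (he : Function.Injective e) (hI : ∀ i, i ∉ I → ∃ s, e s = i)
    {v : Fin n → ℝ} (hv : ∀ i ∈ I, v i = 0) : ∃ w, Function.extend e w 0 = v := by
  refine ⟨v ∘ e, funext fun i ↦ ?_⟩
  by_cases hi : ∃ s, e s = i
  · obtain ⟨s, rfl⟩ := hi
    rw [he.extend_apply, Function.comp_apply]
  · rw [Function.extend_apply' _ _ _ hi, hv i (by_contra fun h ↦ hi (hI i h)), Pi.zero_apply]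

theorem extend_injective (he : Function.Injective e) :
    Function.Injective fun w : ι → ℝ ↦ Function.extend e w 0 := by
  intro w w' h
  ext s
  have := congr_fun h (e s)
  simpa [he.extend_apply] using this

theorem extend_add_indicator_mem_box_iff (he : Function.Injective e)
    (hI : ∀ i, i ∉ I ↔ ∃ s, e s = i) (w : ι → ℝ) :
    (∀ i, 0 ≤ (Function.extend e w 0 + (I : Set (Fin n)).indicator (1 : Fin n → ℝ)) i ∧
      (Function.extend e w 0 + (I : Set (Fin n)).indicator (1 : Fin n → ℝ)) i ≤ 1) ↔
      ∀ s, 0 ≤ w s ∧ w s ≤ 1 := by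
  have hs : ∀ s, e s ∉ I := fun s ↦ (hI _).2 ⟨s, rfl⟩
  constructor
  · intro h s
    have := h (e s)
    simpa [he.extend_apply, hs s] using this
  · intro h i
    by_cases hi : i ∈ I
    · simp [extend_zero_of_mem hs w hi, hi]
    · obtain ⟨s, rfl⟩ := (hI i).1 hi
      simpa [he.extend_apply, hs s] using h s

theorem sum_extend_add_indicator [Fintype ι] (he : Function.Injective e) (w : ι → ℝ)
    (S : Finset (Fin n)) :
    ∑ i ∈ S, (Function.extend e w 0 + (I : Set (Fin n)).indicator (1 : Fin n → ℝ)) i =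
      ∑ s with e s ∈ S, w s + ((I ∩ S).card : ℝ) := by
  simp only [Pi.add_apply]
  rw [Finset.sum_add_distrib, sum_indicator_one]
  congr 1
  calc ∑ i ∈ S, Function.extend e w 0 i
      = ∑ i ∈ (Finset.univ.filter fun s ↦ e s ∈ S).map ⟨e, he⟩, Function.extend e w 0 i := by
        symm
        refine Finset.sum_subset (fun i hi ↦ ?_) fun i hi hni ↦ ?_
        · obtain ⟨s, hs, rfl⟩ := Finset.mem_map.1 hi
          exact (Finset.mem_filter.1 hs).2
        · refine Function.extend_apply' _ _ _ ?_
          rintro ⟨s, rfl⟩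
          exact hni (Finset.mem_map.2 ⟨s, Finset.mem_filter.2 ⟨Finset.mem_univ _, hi⟩, rfl⟩)
    _ = ∑ s with e s ∈ S, w s := by
        rw [Finset.sum_map]
        exact Finset.sum_congr rfl fun s _ ↦ he.extend_apply w 0 s

theorem extend_mem_hypersimplex_iff {m : ℕ} {e : Fin m → Fin n} (he : Function.Injective e)
    (hI : ∀ i, i ∉ I ↔ ∃ s, e s = i) (hk : I.card ≤ k) (w : Fin m → ℝ) :
    Function.extend e w 0 + (I : Set (Fin n)).indicator (1 : Fin n → ℝ) ∈ hypersimplex k n ↔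
      w ∈ hypersimplex (k - I.card) m := by
  rw [mem_hypersimplex, mem_hypersimplex, extend_add_indicator_mem_box_iff he hI,
    sum_extend_add_indicator he]
  refine and_congr_right fun _ ↦ ?_
  simp only [Finset.mem_univ, Finset.filter_true, Finset.inter_univ, Nat.cast_sub hk]
  exact eq_sub_iff_add_eq.symm

theorem extend_mem_schubertPolytope_iff {m r : ℕ} {e : Fin m → Fin n} (he : Function.Injective e)
    (hI : ∀ i, i ∉ I ↔ ∃ s, e s = i) (hk : I.card ≤ k) (hr : I.card ≤ r) {F : Finset (Fin n)}
    (hIF : I ⊆ F) (w : Fin m → ℝ) :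
    Function.extend e w 0 + (I : Set (Fin n)).indicator (1 : Fin n → ℝ) ∈ schubertPolytope k F r ↔
      w ∈ schubertPolytope (k - I.card) (Finset.univ.filter fun s ↦ e s ∈ F) (r - I.card) := by
  refine and_congr (extend_mem_hypersimplex_iff he hI hk w) ?_
  rw [sum_extend_add_indicator he, Finset.inter_eq_left.2 hIF, Nat.cast_sub hr, le_sub_iff_add_le]

end Extension

/-! ### The correction term and the two cases -/

section CoveringPair

variable {n k a b : ℕ} {F G : Finset (Fin n)}

theorem exists_enumeration (hFG : F ∪ G = Finset.univ) (ha : (F \ G).card = a)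
    (hb : (G \ F).card = b) : ∃ e : Fin a ⊕ Fin b → Fin n, Function.Injective e ∧
      (∀ i, i ∉ F ∩ G ↔ ∃ s, e s = i) ∧ (∀ s, e (Sum.inl s) ∈ F \ G) ∧
        ∀ s, e (Sum.inr s) ∈ G \ F := by
  have h1 : ∀ s, (F \ G).orderEmbOfFin ha s ∈ F \ G := fun s ↦ Finset.orderEmbOfFin_mem _ ha s
  have h2 : ∀ s, (G \ F).orderEmbOfFin hb s ∈ G \ F := fun s ↦ Finset.orderEmbOfFin_mem _ hb s
  refine ⟨Sum.elim ((F \ G).orderEmbOfFin ha) ((G \ F).orderEmbOfFin hb), ?_, fun i ↦ ?_, h1, h2⟩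
  · refine ((F \ G).orderEmbOfFin ha).injective.sumElim ((G \ F).orderEmbOfFin hb).injective ?_
    intro s t h
    have h3 := h1 s
    rw [h] at h3
    exact (Finset.mem_sdiff.1 h3).2 (Finset.mem_sdiff.1 (h2 t)).1
  · constructor
    · intro hi
      have hmem : i ∈ F ∪ G := hFG ▸ Finset.mem_univ i
      by_cases hF : i ∈ F
      · have : i ∈ Set.range ((F \ G).orderEmbOfFin ha) := by
          rw [Finset.range_orderEmbOfFin]
          exact Finset.mem_sdiff.2 ⟨hF, fun hG ↦ hi (Finset.mem_inter.2 ⟨hF, hG⟩)⟩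
        obtain ⟨s, hs⟩ := this
        exact ⟨Sum.inl s, hs⟩
      · have : i ∈ Set.range ((G \ F).orderEmbOfFin hb) := by
          rw [Finset.range_orderEmbOfFin]
          exact Finset.mem_sdiff.2 ⟨(Finset.mem_union.1 hmem).resolve_left hF, hF⟩
        obtain ⟨s, hs⟩ := this
        exact ⟨Sum.inr s, hs⟩
    · rintro ⟨s | s, rfl⟩
      · exact fun h ↦ (Finset.mem_sdiff.1 (h1 s)).2 (Finset.mem_inter.1 h).2
      · exact fun h ↦ (Finset.mem_sdiff.1 (h2 s)).2 (Finset.mem_inter.1 h).1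

/-- `F \ G` is listed first because `uPoly` takes an initial segment as cyclic flat. -/
theorem exists_initial_enumeration (hFG : F ∪ G = Finset.univ) (ha : (F \ G).card = a)
    (hb : (G \ F).card = b) : ∃ e : Fin (a + b) → Fin n, Function.Injective e ∧
      (∀ i, i ∉ F ∩ G ↔ ∃ s, e s = i) ∧ ∀ s, e s ∈ F ↔ (s : ℕ) < a := by
  obtain ⟨e, he, hI, h1, h2⟩ := exists_enumeration hFG ha hb
  refine ⟨e ∘ finSumFinEquiv.symm, he.comp finSumFinEquiv.symm.injective, fun i ↦ ?_, fun s ↦ ?_⟩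
  · rw [hI, finSumFinEquiv.symm.surjective.exists]
    rfl
  · obtain ⟨s | s, rfl⟩ := finSumFinEquiv.surjective s
    · have := h1 s
      simp_all
    · have := h2 s
      simp_all

/-- The faces of the hypersimplex on which the coordinates in `F ∩ G` are `1`. -/
theorem fPoly_hypersimplex_eq_sum (hFG : F ∪ G = Finset.univ) (ha : (F \ G).card = a)
    (hb : (G \ F).card = b) (hk : (F ∩ G).card ≤ k) {F' G' : Finset (Fin n)} {p q : ℝ}
    (heq : hypersimplex k n = hypersimplexSlice k F' G' p q) :
    fPoly (hypersimplex (k - (F ∩ G).card) (a + b)) =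
      ∑ T with upperIndices (F ∩ G) ⊆ T, sliceTerm k F' G' p q T := by
  obtain ⟨e, he, hI, -⟩ := exists_initial_enumeration hFG ha hb
  rw [fPoly_eq_facePoly, ← facePoly_slice_preimage (Function.ExtendByZero.linearMap ℝ e)
    (extend_injective he) (fun w i hi ↦ extend_zero_of_mem (fun s ↦ (hI _).2 ⟨s, rfl⟩) w hi)
    (fun v hv ↦ exists_extend_eq he (fun i ↦ (hI i).1) hv), ← heq]
  congr 1
  ext w
  exact (extend_mem_hypersimplex_iff he hI hk w).symm

/-- The faces of the Schubert polytope on which the coordinates in `F ∩ G` are `1`. -/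
theorem fPoly_schubertPolytope_eq_sum (hFG : F ∪ G = Finset.univ) (ha : (F \ G).card = a)
    (hb : (G \ F).card = b) (hk : (F ∩ G).card ≤ k) {r : ℕ} (hr : (F ∩ G).card ≤ r)
    {F' G' : Finset (Fin n)} {p q : ℝ}
    (heq : schubertPolytope k F r = hypersimplexSlice k F' G' p q) :
    fPoly (schubertPolytope (k - (F ∩ G).card)
        (Finset.univ.filter fun i : Fin (a + b) ↦ (i : ℕ) < a) (r - (F ∩ G).card)) =
      ∑ T with upperIndices (F ∩ G) ⊆ T, sliceTerm k F' G' p q T := by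
  obtain ⟨e, he, hI, hF⟩ := exists_initial_enumeration hFG ha hb
  rw [fPoly_eq_facePoly, ← facePoly_slice_preimage (Function.ExtendByZero.linearMap ℝ e)
    (extend_injective he) (fun w i hi ↦ extend_zero_of_mem (fun s ↦ (hI _).2 ⟨s, rfl⟩) w hi)
    (fun v hv ↦ exists_extend_eq he (fun i ↦ (hI i).1) hv), ← heq]
  congr 1
  ext w
  have h := extend_mem_schubertPolytope_iff he hI hk hr Finset.inter_subset_left w
  simp only [hF] at h
  exact h.symm

/-- The faces of the doubly cut hypersimplex on which the coordinates in `F ∩ G` are `1`, when the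
two cuts meet in such a face only. -/
theorem fPoly_hypersimplex_mul_eq_sum (hFG : F ∪ G = Finset.univ) (ha : (F \ G).card = a)
    (hb : (G \ F).card = b) {rF rG : ℕ} (hF : (F ∩ G).card ≤ rF) (hG : (F ∩ G).card ≤ rG)
    (hk : (F ∩ G).card + k = rF + rG) :
    fPoly (hypersimplex (rF - (F ∩ G).card) a) * fPoly (hypersimplex (rG - (F ∩ G).card) b) =
      ∑ T with upperIndices (F ∩ G) ⊆ T, sliceTerm k F G rF rG T := by
  obtain ⟨e, he, hI, h1, h2⟩ := exists_enumeration hFG ha hb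
  rw [fPoly_eq_facePoly, fPoly_eq_facePoly, hypersimplex_eq_polyhedron,
    hypersimplex_eq_polyhedron, ← facePoly_prod, ← hypersimplex_eq_polyhedron,
    ← hypersimplex_eq_polyhedron]
  set E := LinearEquiv.sumArrowLequivProdArrow (Fin a) (Fin b) ℝ ℝ
  rw [← facePoly_slice_preimage ((Function.ExtendByZero.linearMap ℝ e).comp E.symm.toLinearMap)
    ((extend_injective he).comp E.symm.injective)
    (fun w i hi ↦ extend_zero_of_mem (fun s ↦ (hI _).2 ⟨s, rfl⟩) (E.symm w) hi)
    (fun v hv ↦ by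
      obtain ⟨w, hw⟩ := exists_extend_eq he (fun i ↦ (hI i).1) hv
      exact ⟨E w,
        (congr_arg (Function.ExtendByZero.linearMap ℝ e) (E.symm_apply_apply w)).trans hw⟩)]
  congr 1
  ext ⟨u, v⟩
  have hx : (Function.ExtendByZero.linearMap ℝ e ∘ₗ E.symm.toLinearMap) (u, v) =
    Function.extend e (Sum.elim u v) 0 := rfl
  rw [Set.mem_ofPred_eq, hx, mem_hypersimplexSlice, extend_add_indicator_mem_box_iff he hI,
    sum_extend_add_indicator he, sum_extend_add_indicator he, sum_extend_add_indicator he]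
  have hs1 : ∑ s with e s ∈ F, Sum.elim u v s = ∑ s, u s := by
    rw [Finset.sum_filter, Fintype.sum_sum_type]
    have h3 : ∀ s, e (Sum.inl s) ∈ F := fun s ↦ (Finset.mem_sdiff.1 (h1 s)).1
    have h4 : ∀ s, e (Sum.inr s) ∉ F := fun s ↦ (Finset.mem_sdiff.1 (h2 s)).2
    simp [h3, h4]
  have hs2 : ∑ s with e s ∈ G, Sum.elim u v s = ∑ s, v s := by
    rw [Finset.sum_filter, Fintype.sum_sum_type]
    have h3 : ∀ s, e (Sum.inl s) ∉ G := fun s ↦ (Finset.mem_sdiff.1 (h1 s)).2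
    have h4 : ∀ s, e (Sum.inr s) ∈ G := fun s ↦ (Finset.mem_sdiff.1 (h2 s)).1
    simp [h3, h4]
  rw [hs1, hs2, Finset.inter_eq_left.2 Finset.inter_subset_left,
    Finset.inter_eq_left.2 Finset.inter_subset_right]
  have hk' : ((F ∩ G).card : ℝ) + k = rF + rG := by exact_mod_cast hk
  simp only [Set.mem_prod, mem_hypersimplex, Sum.forall, Sum.elim_inl, Sum.elim_inr,
    Finset.mem_univ, Finset.filter_true, Finset.inter_univ, Fintype.sum_sum_type,
    Nat.cast_sub hF, Nat.cast_sub hG]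
  -- The two cuts bound the sums of `u` and `v` by `rF - c` and `rG - c`, while the total is `k -
  -- c`, the sum of these bounds; hence both are equalities.
  constructor
  · rintro ⟨⟨hu, hu'⟩, hv, hv'⟩
    exact ⟨⟨⟨hu, hv⟩, by linarith⟩, by linarith, by linarith⟩
  · rintro ⟨⟨⟨hu, hv⟩, h3⟩, h4, h5⟩
    exact ⟨⟨hu, by linarith⟩, hv, by linarith⟩

/-- The polynomial `w` in terms of faces on which the coordinates in `F ∩ G` are `1`. -/
theorem wPoly_eq_sum (hFG : F ∪ G = Finset.univ) {rF rG : ℕ} (hF : (F ∩ G).card ≤ rF)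
    (hG : (F ∩ G).card ≤ rG) (hk : (F ∩ G).card + k = rF + rG) :
    wPoly (rF - (F ∩ G).card) (rG - (F ∩ G).card)
        (F.card - (F ∩ G).card) (G.card - (F ∩ G).card) =
      ∑ T with upperIndices (F ∩ G) ⊆ T, sliceTerm k F G rF (k + 1) T +
      ∑ T with upperIndices (F ∩ G) ⊆ T, sliceTerm k F G (k + 1) rG T -
      ∑ T with upperIndices (F ∩ G) ⊆ T, sliceTerm k F G (k + 1) (k + 1) T -
      ∑ T with upperIndices (F ∩ G) ⊆ T, sliceTerm k F G rF rG T := by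
  have ha : (F \ G).card = F.card - (F ∩ G).card := by
    rw [Finset.card_sdiff, Finset.inter_comm]
  have hb : (G \ F).card = G.card - (F ∩ G).card := Finset.card_sdiff
  have hck : (F ∩ G).card ≤ k := by omega
  have hsub : rF - (F ∩ G).card + (rG - (F ∩ G).card) = k - (F ∩ G).card := by omega
  have hS := fPoly_schubertPolytope_eq_sum hFG ha hb hck hF
    (schubertPolytope_eq_slice_left k rF F G)
  have hΔ := fPoly_hypersimplex_eq_sum hFG ha hb hck (hypersimplex_eq_slice k F G)
  have hGF : G ∪ F = Finset.univ := Finset.union_comm F G ▸ hFG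
  -- The second `uPoly` puts `G \ F` first, so `F` and `G` trade places.
  have hT := fPoly_schubertPolytope_eq_sum (k := k) (r := rG) hGF hb ha
    (Finset.inter_comm F G ▸ hck) (Finset.inter_comm F G ▸ hG)
    (schubertPolytope_eq_slice_right k rG F G)
  rw [Finset.inter_comm G F, add_comm (G.card - _)] at hT
  rw [wPoly, uPoly, uPoly, hsub, fPoly_hypersimplex_mul_eq_sum hFG ha hb hF hG hk, hS, hT, hΔ]
  ring

theorem sliceTerm_eq_add {p q : ℝ} {T : Finset (((Fin n ⊕ Fin n) ⊕ Bool) ⊕ Bool)}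
    (h : ∀ x ∈ hypersimplex k n, tight (hypersimplexForm n) (hypersimplexBound k n) x = T.toLeft →
      p ≤ ∑ i ∈ F, x i → q ≤ ∑ i ∈ G, x i → False) :
    sliceTerm k F G p q T = sliceTerm k F G p (k + 1) T + sliceTerm k F G (k + 1) q T -
      sliceTerm k F G (k + 1) (k + 1) T := by
  simp only [hypersimplex_eq_polyhedron, ← coordSum_apply] at h
  exact realized_cut_add (fun x hx ↦ coordSum_lt hx F) (fun x hx ↦ coordSum_lt hx G) h _

theorem sum_inter_eq (hFG : F ∪ G = Finset.univ) {x : Fin n → ℝ} (hx : x ∈ hypersimplex k n) :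
    ∑ i ∈ F ∩ G, x i = ∑ i ∈ F, x i + ∑ i ∈ G, x i - k := by
  have h := Finset.sum_union_inter (s₁ := F) (s₂ := G) (f := x)
  rw [hFG, (mem_hypersimplex.1 hx).2] at h
  linarith

theorem sum_le_card {x : Fin n → ℝ} (hx : x ∈ hypersimplex k n) (S : Finset (Fin n)) :
    ∑ i ∈ S, x i ≤ S.card := by
  simpa using Finset.sum_le_sum (s := S) fun i _ ↦ ((mem_hypersimplex.1 hx).1 i).2

theorem eq_one_of_card_le_sum {x : Fin n → ℝ} (hx : x ∈ hypersimplex k n) {S : Finset (Fin n)}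
    (hS : S.card ≤ ∑ i ∈ S, x i) : ∀ i ∈ S, x i = 1 := by
  refine (Finset.sum_eq_sum_iff_of_le fun i _ ↦ ((mem_hypersimplex.1 hx).1 i).2).1 ?_
  simpa using (sum_le_card hx S).antisymm hS

theorem facePoly_slice_of_lt (hFG : F ∪ G = Finset.univ) {rF rG : ℕ}
    (hlt : (F ∩ G).card + k < rF + rG) :
    facePoly (hypersimplexSlice k F G rF rG) =
      facePoly (hypersimplexSlice k F G rF (k + 1)) +
      facePoly (hypersimplexSlice k F G (k + 1) rG) -
      facePoly (hypersimplexSlice k F G (k + 1) (k + 1)) := by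
  simp only [facePoly_slice]
  rw [← Finset.sum_add_distrib, ← Finset.sum_sub_distrib]
  refine Finset.sum_congr rfl fun T _ ↦ sliceTerm_eq_add fun x hx _ h1 h2 ↦ ?_
  have h3 := sum_le_card hx (F ∩ G)
  rw [sum_inter_eq hFG hx] at h3
  have h4 : ((F ∩ G).card : ℝ) + k < rF + rG := by exact_mod_cast hlt
  linarith

theorem facePoly_slice_of_eq (hFG : F ∪ G = Finset.univ) {rF rG : ℕ} (hF : (F ∩ G).card ≤ rF)
    (hG : (F ∩ G).card ≤ rG) (hk : (F ∩ G).card + k = rF + rG) :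
    facePoly (hypersimplexSlice k F G rF rG) =
      facePoly (hypersimplexSlice k F G rF (k + 1)) +
      facePoly (hypersimplexSlice k F G (k + 1) rG) -
      facePoly (hypersimplexSlice k F G (k + 1) (k + 1)) -
      wPoly (rF - (F ∩ G).card) (rG - (F ∩ G).card)
        (F.card - (F ∩ G).card) (G.card - (F ∩ G).card) := by
  have key : ∑ T with ¬ upperIndices (F ∩ G) ⊆ T, sliceTerm k F G rF rG T =
      ∑ T with ¬ upperIndices (F ∩ G) ⊆ T, sliceTerm k F G rF (k + 1) T +
      ∑ T with ¬ upperIndices (F ∩ G) ⊆ T, sliceTerm k F G (k + 1) rG T -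
      ∑ T with ¬ upperIndices (F ∩ G) ⊆ T, sliceTerm k F G (k + 1) (k + 1) T := by
    rw [← Finset.sum_add_distrib, ← Finset.sum_sub_distrib]
    refine Finset.sum_congr rfl fun T hT ↦ sliceTerm_eq_add fun x hx hxT h1 h2 ↦ ?_
    have hk' : ((F ∩ G).card : ℝ) + k = rF + rG := by exact_mod_cast hk
    have h3 := eq_one_of_card_le_sum hx (S := F ∩ G) (by
      rw [sum_inter_eq hFG hx]
      linarith)
    -- A point in both cut-off regions makes `T` contain all of `upperIndices (F ∩ G)`, contrary to
    -- the choice of `T`.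
    refine (Finset.mem_filter.1 hT).2 fun j hj ↦ ?_
    obtain ⟨i, hi, rfl⟩ := Finset.mem_map.1 hj
    have h4 : Sum.inl (Sum.inr i) ∈ T.toLeft := by
      rw [← hxT, mem_tight]
      exact h3 i hi
    exact Finset.mem_toLeft.1 h4
  rw [wPoly_eq_sum hFG hF hG hk]
  simp only [facePoly_slice_eq_add (F ∩ G)]
  rw [key]
  ring

end CoveringPair

end SplitMatroidFaces

theorem lemma2p2 (n k rF rG : ℕ) (N : Matroid (Fin n)) (F G : Finset (Fin n))
    (hE : N.E = Set.univ)
    (hcyc : {Z : Set (Fin n) | N.IsCyclicFlat Z} =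
      {(∅ : Set (Fin n)), (F : Set (Fin n)), (G : Set (Fin n)), (Set.univ : Set (Fin n))})
    (hfour : {Z : Set (Fin n) | N.IsCyclicFlat Z}.ncard = 4)
    (hFG : F ∪ G = Finset.univ)
    (hk : N.eRank = (k : ℕ∞))
    (hrF : N.eRk (F : Set (Fin n)) = (rF : ℕ∞))
    (hrG : N.eRk (G : Set (Fin n)) = (rG : ℕ∞)) :
    (F ∩ G).card + k ≤ rF + rG ∧
    ((F ∩ G).card + k < rF + rG →
      fPoly (basePolytope N) =
        fPoly (schubertPolytope k F rF) + fPoly (schubertPolytope k G rG) -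
          fPoly (hypersimplex k n)) ∧
    ((F ∩ G).card + k = rF + rG →
      fPoly (basePolytope N) =
        fPoly (schubertPolytope k F rF) + fPoly (schubertPolytope k G rG) -
          fPoly (hypersimplex k n) -
          wPoly (rF - (F ∩ G).card) (rG - (F ∩ G).card)
            (F.card - (F ∩ G).card) (G.card - (F ∩ G).card)) := by
  have hind := indep_inter hE hcyc hfour hFG
  have hcF : (F ∩ G).card ≤ rF := card_le_of_indep hind (by simp) hrF
  have hcG : (F ∩ G).card ≤ rG := card_le_of_indep hind (by simp) hrG
  rw [basePolytope_eq_slice hE hcyc hFG hk hrF hrG, schubertPolytope_eq_slice_left k rF F G,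
    schubertPolytope_eq_slice_right k rG F G, hypersimplex_eq_slice k F G]
  exact ⟨card_inter_add_le hE hind hFG hk hrF hrG, facePoly_slice_of_lt hFG,
    facePoly_slice_of_eq hFG hcF hcG⟩
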